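/- Let $\mathbb{K}\in\{\mathbb{R},\mathbb{C}\}$, and let $\Delta_{\mathrm D}$ be the Dirichlet Laplacian on $(0,\infty)$, i.e. the operator on $L_2(0,\infty)=L_2((0,\infty);\mathbb{K})$ with domain $\operatorname{dom}(\Delta_{\mathrm D})=\{u\in H_0^1(0,\infty) : u''\in L_2(0,\infty)\}$ (weak second derivative) and $\Delta_{\mathrm D}u=u''$, where $H_0^1(0,\infty)$ is the closure of $C_c^\infty(0,\infty)$ in $H^1(0,\infty)$. Let $V\colon(0,\infty)\to\mathbb{R}$ be measurable and let $\alpha\in(0,1)$ be such that $$\int_0^\infty x\,|V(x)|\,dx\le\alpha .$$ Then, for every $u\in\operatorname{dom}(\Delta_{\mathrm D})$, the number $\langle-\Delta_{\mathrm D}u,u\rangle$ (scalar product in $L_2(0,\infty)$) is real, the function $|V|\,|u|^2$ is integrable on $(0,\infty)$, and $$\int_0^\infty |V|\,|u|^2\,dx\le\alpha\,\langle-\Delta_{\mathrm D}u,u\rangle .$$ -/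

import Mathlib

open Set MeasureTheory
open scoped ContDiff ENNReal

namespace HalfLine

/-- Lebesgue measure on the half-line `(0,∞)`. -/
noncomputable abbrev μ : Measure ℝ := volume.restrict (Ioi (0 : ℝ))

/-- The Hilbert space `L₂(0,∞)` of `𝕜`-valued functions. -/
abbrev L2 (𝕜 : Type*) [RCLike 𝕜] : Type _ := Lp 𝕜 2 μ

/-- `φ ∈ C_c^∞(0,∞)`, as a function on `ℝ` extended by zero. -/
structure IsTestFunction {𝕜 : Type*} [RCLike 𝕜] (φ : ℝ → 𝕜) : Prop where
  smooth : ContDiff ℝ ∞ φ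
  hasCompactSupport : HasCompactSupport φ
  tsupport_subset : tsupport φ ⊆ Ioi 0

section TestFunction

variable {𝕜 : Type*} [RCLike 𝕜]

theorem IsTestFunction.zero : IsTestFunction (0 : ℝ → 𝕜) :=
  ⟨contDiff_const, HasCompactSupport.zero, by simp [tsupport]⟩

theorem IsTestFunction.add {φ ψ : ℝ → 𝕜} (hφ : IsTestFunction φ) (hψ : IsTestFunction ψ) :
    IsTestFunction (φ + ψ) :=
  ⟨hφ.smooth.add hψ.smooth, hφ.hasCompactSupport.add hψ.hasCompactSupport,
    (tsupport_add φ ψ).trans (union_subset hφ.tsupport_subset hψ.tsupport_subset)⟩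

theorem IsTestFunction.smul (c : 𝕜) {φ : ℝ → 𝕜} (hφ : IsTestFunction φ) :
    IsTestFunction (c • φ) :=
  ⟨hφ.smooth.const_smul c, hφ.hasCompactSupport.smul_left (f := fun _ => c),
    (tsupport_smul_subset_right (fun _ => c) φ).trans hφ.tsupport_subset⟩

theorem IsTestFunction.deriv {φ : ℝ → 𝕜} (hφ : IsTestFunction φ) :
    IsTestFunction (_root_.deriv φ) :=
  ⟨((contDiff_infty_iff_deriv (𝕜 := ℝ)).1 hφ.smooth).2, hφ.hasCompactSupport.deriv,
    (closure_mono (support_deriv_subset)).trans (by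
      rw [(isClosed_tsupport φ).closure_eq]; exact hφ.tsupport_subset)⟩

theorem IsTestFunction.iteratedDeriv (n : ℕ) {φ : ℝ → 𝕜} (hφ : IsTestFunction φ) :
    IsTestFunction (_root_.iteratedDeriv n φ) := by
  induction n with
  | zero => simpa using hφ
  | succ n ih => rw [iteratedDeriv_succ]; exact ih.deriv

theorem IsTestFunction.memLp {φ : ℝ → 𝕜} (hφ : IsTestFunction φ) : MemLp φ 2 μ :=
  hφ.smooth.continuous.memLp_of_hasCompactSupport hφ.hasCompactSupport

theorem IsTestFunction.integrable_mul {φ : ℝ → 𝕜} (hφ : IsTestFunction φ) (f : L2 𝕜) :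
    Integrable (fun x => f x * φ x) μ :=
  (Lp.memLp f).integrable_mul hφ.memLp

end TestFunction

/-- The pairs `(f, g)` in `L₂(0,∞) × L₂(0,∞)` such that `g` is the `n`-th weak derivative of `f` on
`(0,∞)`, that is, `∫ f φ⁽ⁿ⁾ = (-1)ⁿ ∫ g φ` for all `φ ∈ C_c^∞(0,∞)`. -/
def weakDerivGraph (𝕜 : Type*) [RCLike 𝕜] (n : ℕ) : Submodule 𝕜 (L2 𝕜 × L2 𝕜) where
  carrier := {p | ∀ φ : ℝ → 𝕜, IsTestFunction φ →
    ∫ x, p.1 x * iteratedDeriv n φ x ∂μ = (-1) ^ n * ∫ x, p.2 x * φ x ∂μ}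
  zero_mem' := by
    intro φ _
    have h0 : ∀ ψ : ℝ → 𝕜, ∫ x, (0 : L2 𝕜) x * ψ x ∂μ = 0 := by
      intro ψ
      rw [integral_congr_ae (g := fun _ => (0 : 𝕜))]
      · simp
      · filter_upwards [Lp.coeFn_zero 𝕜 2 μ] with x hx
        rw [hx, Pi.zero_apply, zero_mul]
    simp only [Prod.fst_zero, Prod.snd_zero, h0, mul_zero]
  add_mem' := by
    intro p q hp hq φ hφ
    have hadd : ∀ (f g : L2 𝕜) (ψ : ℝ → 𝕜), IsTestFunction ψ →
        ∫ x, (f + g) x * ψ x ∂μ = ∫ x, f x * ψ x ∂μ + ∫ x, g x * ψ x ∂μ := by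
      intro f g ψ hψ
      rw [← integral_add (hψ.integrable_mul f) (hψ.integrable_mul g)]
      refine integral_congr_ae ?_
      filter_upwards [Lp.coeFn_add f g] with x hx
      rw [hx, Pi.add_apply, add_mul]
    simp only [Prod.fst_add, Prod.snd_add]
    rw [hadd _ _ _ (hφ.iteratedDeriv n), hadd _ _ _ hφ, hp φ hφ, hq φ hφ, mul_add]
  smul_mem' := by
    intro c p hp φ hφ
    have hsmul : ∀ (f : L2 𝕜) (ψ : ℝ → 𝕜),
        ∫ x, (c • f) x * ψ x ∂μ = c * ∫ x, f x * ψ x ∂μ := by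
      intro f ψ
      rw [← integral_const_mul]
      refine integral_congr_ae ?_
      filter_upwards [Lp.coeFn_smul c f] with x hx
      rw [hx, Pi.smul_apply, smul_eq_mul, mul_assoc]
    simp only [Prod.smul_fst, Prod.smul_snd]
    rw [hsmul, hsmul, hp φ hφ, mul_left_comm]

/-- The pairs `(φ, φ')` in `L₂(0,∞) × L₂(0,∞)` with `φ ∈ C_c^∞(0,∞)`. -/
def testGraph (𝕜 : Type*) [RCLike 𝕜] : Submodule 𝕜 (L2 𝕜 × L2 𝕜) where
  carrier := {p | ∃ φ : ℝ → 𝕜, IsTestFunction φ ∧ p.1 =ᵐ[μ] φ ∧ p.2 =ᵐ[μ] deriv φ}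
  zero_mem' := by
    refine ⟨0, IsTestFunction.zero, Lp.coeFn_zero 𝕜 2 μ, ?_⟩
    filter_upwards [Lp.coeFn_zero 𝕜 2 μ] with x hx
    simpa using hx
  add_mem' := by
    rintro p q ⟨φ, hφ, hp1, hp2⟩ ⟨ψ, hψ, hq1, hq2⟩
    refine ⟨φ + ψ, hφ.add hψ, (Lp.coeFn_add _ _).trans (hp1.add hq1), ?_⟩
    have hd : deriv (φ + ψ) = deriv φ + deriv ψ := by
      ext x
      exact deriv_add (hφ.smooth.differentiable (by simp) x)
        (hψ.smooth.differentiable (by simp) x)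
    rw [hd]
    exact (Lp.coeFn_add _ _).trans (hp2.add hq2)
  smul_mem' := by
    rintro c p ⟨φ, hφ, hp1, hp2⟩
    refine ⟨c • φ, hφ.smul c, (Lp.coeFn_smul _ _).trans (hp1.const_smul c), ?_⟩
    have hd : deriv (c • φ) = c • deriv φ := by
      ext x
      exact deriv_const_smul c (hφ.smooth.differentiable (by simp) x)
    rw [hd]
    exact (Lp.coeFn_smul _ _).trans (hp2.const_smul c)

/-- The Sobolev space `H¹₀(0,∞)`: the closure of `C_c^∞(0,∞)` in `H¹(0,∞)`, where `H¹(0,∞)` is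
identified with the space of pairs `(u, u')`, whose norm in `L₂ × L₂` is equivalent to the norm of
`H¹`. -/
noncomputable def H10 (𝕜 : Type*) [RCLike 𝕜] : Submodule 𝕜 (L2 𝕜) :=
  (weakDerivGraph 𝕜 1 ⊓ (testGraph 𝕜).topologicalClosure).map (LinearMap.fst 𝕜 (L2 𝕜) (L2 𝕜))

/-- The graph of the Dirichlet Laplacian on `(0,∞)`: the pairs `(u, w)` with `u ∈ H¹₀(0,∞)` and
`w = u'' ∈ L₂(0,∞)` in the weak sense. -/
noncomputable def dirichletLaplacianGraph (𝕜 : Type*) [RCLike 𝕜] : Submodule 𝕜 (L2 𝕜 × L2 𝕜) :=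
  (H10 𝕜).comap (LinearMap.fst 𝕜 (L2 𝕜) (L2 𝕜)) ⊓ weakDerivGraph 𝕜 2

/-- The Dirichlet Laplacian `Δ_D` on `(0,∞)`, with domain `{u ∈ H¹₀(0,∞) : u'' ∈ L₂(0,∞)}` and
`Δ_D u = u''`. -/
noncomputable def dirichletLaplacian (𝕜 : Type*) [RCLike 𝕜] : L2 𝕜 →ₗ.[𝕜] L2 𝕜 :=
  (dirichletLaplacianGraph 𝕜).toLinearPMap

section WellDefined

variable {𝕜 : Type*} [RCLike 𝕜]

/-- The weak second derivative is unique, so `dirichletLaplacianGraph` is the graph of a function. -/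
theorem dirichletLaplacianGraph_snd_eq_zero (p : L2 𝕜 × L2 𝕜)
    (hp : p ∈ dirichletLaplacianGraph 𝕜) (h0 : p.1 = 0) : p.2 = 0 := by
  have hw : ∀ φ : ℝ → 𝕜, IsTestFunction φ → ∫ x, p.2 x * φ x ∂μ = 0 := by
    intro φ hφ
    have h := hp.2 φ hφ
    rw [h0, integral_congr_ae (g := fun _ => (0 : 𝕜))] at h
    · simpa using h.symm
    · filter_upwards [Lp.coeFn_zero 𝕜 2 μ] with x hx
      rw [hx, Pi.zero_apply, zero_mul]
  have hloc : LocallyIntegrable p.2 μ := (Lp.memLp p.2).locallyIntegrable (by norm_num)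
  have h := isOpen_Ioi.ae_eq_zero_of_integral_contDiff_smul_eq_zero (U := Ioi (0 : ℝ))
    (hloc.locallyIntegrableOn _) (fun g hg hgc hgs => by
      have h1 : IsTestFunction (fun x => (g x : 𝕜)) :=
        ⟨(RCLike.ofRealCLM (K := 𝕜)).contDiff.comp hg, hgc.comp_left (g := fun r : ℝ => (r : 𝕜)) (by simp),
          (closure_mono (Function.support_comp_subset (g := fun r : ℝ => (r : 𝕜))
            (by simp) g)).trans hgs⟩
      rw [← hw _ h1]
      refine integral_congr_ae (Filter.Eventually.of_forall fun x => ?_)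
      simp [RCLike.real_smul_eq_coe_mul, mul_comm])
  refine Lp.ext ?_
  filter_upwards [h, ae_restrict_mem measurableSet_Ioi, Lp.coeFn_zero 𝕜 2 μ] with x hx hx' hz
  rw [hz, hx hx', Pi.zero_apply]

theorem dirichletLaplacian_graph :
    (dirichletLaplacian 𝕜).graph = dirichletLaplacianGraph 𝕜 :=
  Submodule.toLinearPMap_graph_eq _ dirichletLaplacianGraph_snd_eq_zero

end WellDefined

end HalfLine

namespace HalfLine

variable {𝕜 : Type*} [RCLike 𝕜]

/-! Writing `g = u'`, the boundary value `u(0) = 0` and Cauchy–Schwarz give `|u(x)|² = |∫₀ˣ g|² ≤ x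
‖g‖²`; integrating against `|V|` yields the factor `∫ x |V| ≤ α`. Integration by parts gives `⟨-u'',
u⟩ = ‖g‖²`, which also shows that this number is real. Both facts are proved for test functions and
extended to `H¹₀` by density (`ae_norm_sq_le`, `inner_fst_eq_neg_inner_snd`). -/

/-- Complex conjugation preserves test functions. -/
theorem IsTestFunction.conj {φ : ℝ → 𝕜} (hφ : IsTestFunction φ) :
    IsTestFunction (fun x => RCLike.conjCLE (K := 𝕜) (φ x)) :=
  ⟨(RCLike.conjCLE (K := 𝕜)).contDiff.comp hφ.smooth,
    hφ.hasCompactSupport.comp_left (g := fun z : 𝕜 => RCLike.conjCLE (K := 𝕜) z) (by simp),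
    (closure_mono (Function.support_comp_subset (g := fun z : 𝕜 => RCLike.conjCLE (K := 𝕜) z)
      (by simp) φ)).trans hφ.tsupport_subset⟩

/-- Complex conjugation of test functions commutes with differentiation. -/
theorem IsTestFunction.deriv_conj {φ : ℝ → 𝕜} (hφ : IsTestFunction φ) (x : ℝ) :
    _root_.deriv (fun x => RCLike.conjCLE (K := 𝕜) (φ x)) x
      = (starRingEnd 𝕜) (_root_.deriv φ x) := by
  have h := ((RCLike.conjCLE (K := 𝕜)).hasFDerivAt (x := φ x)).comp_hasDerivAt x
    (hφ.smooth.differentiable (by simp) x).hasDerivAt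
  simpa [Function.comp_def] using h.deriv

/-- If `g = u'` and `w = u''` weakly, then `w = g'` weakly. -/
theorem weakDerivGraph_one_of_two {u g w : L2 𝕜} (hg : (u, g) ∈ weakDerivGraph 𝕜 1)
    (hw : (u, w) ∈ weakDerivGraph 𝕜 2) : (g, w) ∈ weakDerivGraph 𝕜 1 := by
  intro φ hφ
  -- Testing `g = u'` against `φ'` produces `∫ u φ''`, the same integral as in `h2`.
  have h1 := hg _ hφ.deriv
  have h2 := hw φ hφ
  simp only [iteratedDeriv_succ, iteratedDeriv_zero, pow_one, even_two.neg_pow, one_pow,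
    one_mul, neg_mul] at h1 h2 ⊢
  rw [← h2, h1, neg_neg]

/-- Integration by parts: a weak derivative pairs with the elements of `H¹₀(0,∞)`. -/
theorem inner_fst_eq_neg_inner_snd {g w : L2 𝕜} (hgw : (g, w) ∈ weakDerivGraph 𝕜 1)
    {p : L2 𝕜 × L2 𝕜} (hp : p ∈ (testGraph 𝕜).topologicalClosure) :
    inner 𝕜 p.1 w = -inner 𝕜 p.2 g := by
  -- Both sides are continuous in `p`, so it suffices to treat pairs `(φ, φ')`.
  have hclosed : IsClosed {p : L2 𝕜 × L2 𝕜 | inner 𝕜 p.1 w = -inner 𝕜 p.2 g} :=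
    isClosed_eq (by fun_prop) (by fun_prop)
  refine closure_minimal ?_ hclosed hp
  rintro q ⟨φ, hφ, h1, h2⟩
  -- The weak derivative is defined by a bilinear pairing, while the inner product conjugates its
  -- first argument; hence the test function `φ̄`.
  have h := hgw _ hφ.conj
  simp only [iteratedDeriv_succ, iteratedDeriv_zero, pow_one, neg_mul, one_mul] at h
  have e1 : inner 𝕜 q.1 w = ∫ x, w x * RCLike.conjCLE (K := 𝕜) (φ x) ∂μ := by
    rw [L2.inner_def]
    refine integral_congr_ae ?_
    filter_upwards [h1] with x hx
    rw [hx, RCLike.inner_apply, RCLike.conjCLE_apply]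
  have e2 : inner 𝕜 q.2 g
      = ∫ x, g x * _root_.deriv (fun x => RCLike.conjCLE (K := 𝕜) (φ x)) x ∂μ := by
    rw [L2.inner_def]
    refine integral_congr_ae ?_
    filter_upwards [h2] with x hx
    rw [hx, RCLike.inner_apply, hφ.deriv_conj]
  change inner 𝕜 q.1 w = -inner 𝕜 q.2 g
  rw [e1, e2, h, neg_neg]

/-- The pointwise bound `|φ(x)|² ≤ x ‖φ'‖²` for test functions. -/
theorem IsTestFunction.norm_sq_le {φ : ℝ → 𝕜} (hφ : IsTestFunction φ) {h : L2 𝕜}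
    (hh : h =ᵐ[μ] _root_.deriv φ) {x : ℝ} (hx : 0 < x) : ‖φ x‖ ^ 2 ≤ x * ‖h‖ ^ 2 := by
  have hμ : μ (Ioc 0 x) = ENNReal.ofReal x := by
    rw [Measure.restrict_apply measurableSet_Ioc,
      inter_eq_self_of_subset_left Ioc_subset_Ioi_self, Real.volume_Ioc, sub_zero]
  have hμ' : μ (Ioc 0 x) ≠ ⊤ := by rw [hμ]; exact ENNReal.ofReal_ne_top
  have h0 : φ 0 = 0 := by
    by_contra hne
    exact self_notMem_Ioi (hφ.tsupport_subset (subset_tsupport φ hne))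
  -- The fundamental theorem of calculus, read as the `L²` pairing of `φ'` with the indicator of
  -- `(0, x]`, whose norm is `√x`.
  have hint : φ x = inner 𝕜 (indicatorConstLp 2 measurableSet_Ioc hμ' (1 : 𝕜)) h := by
    rw [L2.inner_indicatorConstLp_one, Measure.restrict_restrict measurableSet_Ioc,
      inter_eq_self_of_subset_left Ioc_subset_Ioi_self,
      integral_congr_ae (ae_restrict_of_ae_restrict_of_subset Ioc_subset_Ioi_self hh),
      ← intervalIntegral.integral_of_le hx.le,
      intervalIntegral.integral_deriv_eq_sub
        (fun y _ => hφ.smooth.differentiable (by simp) y)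
        (hφ.deriv.smooth.continuous.intervalIntegrable _ _), h0, sub_zero]
  have hn : ‖indicatorConstLp 2 measurableSet_Ioc hμ' (1 : 𝕜)‖ = √x := by
    rw [norm_indicatorConstLp (by norm_num) (by norm_num), measureReal_def, hμ,
      ENNReal.toReal_ofReal hx.le, Real.sqrt_eq_rpow]
    simp
  calc ‖φ x‖ ^ 2 ≤ (√x * ‖h‖) ^ 2 := by
        rw [hint, ← hn]
        gcongr
        exact norm_inner_le_norm _ _
    _ = x * ‖h‖ ^ 2 := by rw [mul_pow, Real.sq_sqrt hx.le]

/-- The pointwise bound `|u(x)|² ≤ x ‖u'‖²` for `u ∈ H¹₀(0,∞)`. -/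
theorem ae_norm_sq_le {p : L2 𝕜 × L2 𝕜} (hp : p ∈ (testGraph 𝕜).topologicalClosure) :
    ∀ᵐ x ∂μ, ‖p.1 x‖ ^ 2 ≤ x * ‖p.2‖ ^ 2 := by
  obtain ⟨q, hq, hlim⟩ := mem_closure_iff_seq_limit.1 hp
  have hlim1 : Filter.Tendsto (fun n => (q n).1) Filter.atTop (nhds p.1) :=
    (continuous_fst.tendsto p).comp hlim
  have hlim2 : Filter.Tendsto (fun n => (q n).2) Filter.atTop (nhds p.2) :=
    (continuous_snd.tendsto p).comp hlim
  -- `L²` convergence gives pointwise a.e. convergence only along a subsequence, which is enough to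
  -- pass to the limit in the bound.
  obtain ⟨ns, hns, hae⟩ := (tendstoInMeasure_of_tendsto_Lp hlim1).exists_seq_tendsto_ae
  have hb : ∀ᵐ x ∂μ, ∀ n, ‖(q n).1 x‖ ^ 2 ≤ x * ‖(q n).2‖ ^ 2 := by
    refine ae_all_iff.2 fun n => ?_
    obtain ⟨φ, hφ, h1, h2⟩ := hq n
    filter_upwards [h1, ae_restrict_mem measurableSet_Ioi] with x hx hx0
    rw [hx]
    exact hφ.norm_sq_le h2 hx0
  filter_upwards [hae, hb] with x hx hbx
  exact le_of_tendsto_of_tendsto' (hx.norm.pow 2)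
    (((hlim2.comp hns.tendsto_atTop).norm.pow 2).const_mul x) fun n => hbx (ns n)

/-- An element of the domain of the Dirichlet Laplacian has a weak derivative `g` for which
`⟨u, -Δ u⟩ = ‖g‖²` and `|u(x)|² ≤ x ‖g‖²`. -/
theorem exists_weakDeriv (u : (dirichletLaplacian 𝕜).domain) :
    ∃ g : L2 𝕜, inner 𝕜 (u : L2 𝕜) (-dirichletLaplacian 𝕜 u) = ((‖g‖ ^ 2 : ℝ) : 𝕜) ∧
      ∀ᵐ x ∂μ, ‖(u : L2 𝕜) x‖ ^ 2 ≤ x * ‖g‖ ^ 2 := by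
  have hu : ((u : L2 𝕜), dirichletLaplacian 𝕜 u) ∈ dirichletLaplacianGraph 𝕜 := by
    rw [← dirichletLaplacian_graph]
    exact (dirichletLaplacian 𝕜).mem_graph u
  obtain ⟨⟨⟨v, g⟩, ⟨hg, hcl⟩, hv⟩, hw⟩ := hu
  obtain rfl : v = u := hv
  refine ⟨g, ?_, ae_norm_sq_le hcl⟩
  -- Here `p = (u, g)` itself, so the right-hand side is `-⟨g, g⟩`.
  have h := inner_fst_eq_neg_inner_snd (weakDerivGraph_one_of_two hg hw) hcl
  rw [inner_neg_right, h, neg_neg, inner_self_eq_norm_sq_to_K]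
  push_cast
  rfl

end HalfLine

theorem mainTheorem10 {𝕜 : Type*} [RCLike 𝕜] (V : ℝ → ℝ)
    (hV : AEMeasurable V (volume.restrict (Ioi (0 : ℝ))))
    (α : ℝ) (hα₀ : 0 < α) (hα₁ : α < 1)
    (hint : ∫⁻ x in Ioi (0 : ℝ), ENNReal.ofReal (x * |V x|) ≤ ENNReal.ofReal α)
    (u : (HalfLine.dirichletLaplacian 𝕜).domain) :
    IntegrableOn (fun x : ℝ => |V x| * ‖(u : HalfLine.L2 𝕜) x‖ ^ 2) (Ioi 0) ∧
      RCLike.im (inner 𝕜 (u : HalfLine.L2 𝕜) (-HalfLine.dirichletLaplacian 𝕜 u)) = 0 ∧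
      ∫ x in Ioi (0 : ℝ), |V x| * ‖(u : HalfLine.L2 𝕜) x‖ ^ 2 ≤
        α * RCLike.re (inner 𝕜 (u : HalfLine.L2 𝕜) (-HalfLine.dirichletLaplacian 𝕜 u)) := by
  obtain ⟨g, hg, hb⟩ := HalfLine.exists_weakDeriv u
  rw [hg, RCLike.ofReal_im, RCLike.ofReal_re]
  have hnonneg : 0 ≤ᵐ[volume.restrict (Ioi (0 : ℝ))] fun x => x * |V x| := by
    filter_upwards [ae_restrict_mem measurableSet_Ioi] with x hx
    exact mul_nonneg (le_of_lt hx) (abs_nonneg _)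
  have hmeas : AEStronglyMeasurable (fun x => x * |V x|) (volume.restrict (Ioi (0 : ℝ))) :=
    (aemeasurable_id.mul hV.abs).aestronglyMeasurable
  have hI : IntegrableOn (fun x => x * |V x|) (Ioi 0) :=
    ⟨hmeas, (hasFiniteIntegral_iff_ofReal hnonneg).2 (hint.trans_lt ENNReal.ofReal_lt_top)⟩
  have hIα : ∫ x in Ioi (0 : ℝ), x * |V x| ≤ α := by
    rw [integral_eq_lintegral_of_nonneg_ae hnonneg hmeas]
    exact ENNReal.toReal_le_of_le_ofReal hα₀.le hint
  have hle : ∀ᵐ x ∂volume.restrict (Ioi (0 : ℝ)),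
      |V x| * ‖(u : HalfLine.L2 𝕜) x‖ ^ 2 ≤ x * |V x| * ‖g‖ ^ 2 := by
    filter_upwards [hb] with x hx
    calc |V x| * ‖(u : HalfLine.L2 𝕜) x‖ ^ 2 ≤ |V x| * (x * ‖g‖ ^ 2) := by gcongr
      _ = x * |V x| * ‖g‖ ^ 2 := by ring
  have hJ : IntegrableOn (fun x : ℝ => |V x| * ‖(u : HalfLine.L2 𝕜) x‖ ^ 2) (Ioi 0) := by
    -- Domination by the integrable function `x |V(x)| ‖g‖²`.
    refine (hI.mul_const (‖g‖ ^ 2)).mono'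
      (hV.abs.aestronglyMeasurable.mul ((Lp.aestronglyMeasurable _).norm.pow 2)) ?_
    filter_upwards [hle] with x hx
    rwa [Real.norm_of_nonneg (by positivity)]
  refine ⟨hJ, rfl, ?_⟩
  calc ∫ x in Ioi (0 : ℝ), |V x| * ‖(u : HalfLine.L2 𝕜) x‖ ^ 2
      ≤ ∫ x in Ioi (0 : ℝ), x * |V x| * ‖g‖ ^ 2 :=
        integral_mono_ae hJ (hI.mul_const _) hle
    _ = (∫ x in Ioi (0 : ℝ), x * |V x|) * ‖g‖ ^ 2 := integral_mul_const _ _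
    _ ≤ α * ‖g‖ ^ 2 := by gcongr
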